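/- Let $|\alpha_{00}\rangle=|0\rangle$, $|\alpha_{11}\rangle=|1\rangle$, $|\alpha_{01}\rangle=\tfrac1{\sqrt2}(|0\rangle+|1\rangle)$, $|\alpha_{10}\rangle=\tfrac1{\sqrt2}(|0\rangle-|1\rangle)$. For functions $C,D:\{0,1\}^k\to\{0,1\}^n$ and $s,t\in\{0,1\}^k$ define the $n$-qubit state $$|E(s,t)\rangle=\bigotimes_{a=1}^n|\alpha_{C(s)_a\,D(t)_a}\rangle .$$ A *1-pass LOCC strategy using 2-outcome measurements* on $n$ qubits consists of $n$ steps. At step $a$, given the earlier outcomes $z_{<a}\in\{0,1\}^{a-1}$, it chooses a qubit $Q_a(z_{<a})\in[n]$ and a single-qubit POVM $\{M_a(z_{<a},\zeta)\}_{\zeta\in\{0,1\}}$ (positive semidefinite $2\times2$ matrices summing to $I$, possibly zero), measures that qubit, and records the outcome $z_a$; no qubit is measured twice along any sequence of outcomes. On an $n$-qubit state $|\psi\rangle$ it outputs $z\in\{0,1\}^n$ with probability $\langle\psi|M(z)|\psi\rangle$, where $M(z)=\bigotimes_{a=1}^n M_a(z_{\le a})$ and the factor $M_a(z_{\le a})$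 acts on qubit $Q_a(z_{<a})$. Let $S,T$ be independent and uniform on $\{0,1\}^k$, and let $Z$ be the output of the strategy on the state $|E(S,T)\rangle$. Let $H(\cdot)$, $H(\cdot|\cdot)$ and $I(\cdot\,;\cdot)$ denote Shannon entropy, conditional entropy and mutual information, in bits. Let $p_e=\sin^2(\pi/8)$ and $h(p)=-p\log_2 p-(1-p)\log_2(1-p)$, so that $1-h(p_e)\approx0.3991$. **Theorem.** There are constants $\theta_0>0$, $c>0$, $A$ and $n_0$ such that the following holds for all integers $n\ge n_0$, all real $\theta\in[0,\theta_0]$, and all integers $k\ge 0$ with $k=n(1-h(p_e)-\theta)$. Choose $C,D:\{0,1\}^k\to\{0,1\}^n$ independently and uniformly at random among all functions. Then, with probability at least $1-e^{-cn}$ over $C$ and $D$, every 1-pass LOCC strategy using 2-outcome measurements satisfies $$I(Z;S,T)\le 1.9190\,k+A\sqrt n\,\log n ,$$ and equivalently (since $H(S,T)=2k$) $$H(S,T|Z)\ge 0.081\,k-A\sqrt n\,\log n .$$ -/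

import Mathlib

open scoped BigOperators Matrix ComplexOrder

noncomputable section

/-! ### Shannon information of finite distributions (in bits) -/

/-- Shannon entropy `H(X) = -∑ₓ Pr[X=x] lg Pr[X=x]` of a distribution on a finite type. -/
def shannonEntropy {X : Type*} [Fintype X] (p : X → ℝ) : ℝ :=
  -∑ x, p x * Real.logb 2 (p x)

/-- Conditional entropy `H(X|Y) = ∑_y Pr[Y=y] H(X|Y=y)`, where `p x y = Pr[X=x, Y=y]`.
Values `y` of probability zero contribute nothing. -/
def condEntropy {X Y : Type*} [Fintype X] [Fintype Y] (p : X → Y → ℝ) : ℝ :=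
  ∑ y, (∑ x, p x y) * shannonEntropy (fun x => p x y / ∑ x', p x' y)

/-- Mutual information `I(X;Y) = H(X) - H(X|Y)`, where `p x y = Pr[X=x, Y=y]`. -/
def mutualInfo {X Y : Type*} [Fintype X] [Fintype Y] (p : X → Y → ℝ) : ℝ :=
  shannonEntropy (fun x => ∑ y, p x y) - condEntropy p

/-! ### The conjugate-coding states -/

/-- The bit strings `{0,1}^k`. -/
abbrev BitString (k : ℕ) : Type := Fin k → Fin 2

/-- All functions `{0,1}^k → {0,1}^n`. -/
abbrev Code (k n : ℕ) : Type := BitString k → BitString n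

/-- The single-qubit states `|α₀₀⟩ = |0⟩`, `|α₁₁⟩ = |1⟩`, `|α₀₁⟩ = |+⟩`, `|α₁₀⟩ = |-⟩`. -/
def alphaState : Fin 2 → Fin 2 → (Fin 2 → ℂ)
  | 0, 0 => ![1, 0]
  | 1, 1 => ![0, 1]
  | 0, 1 => ![1 / (Real.sqrt 2 : ℂ), 1 / (Real.sqrt 2 : ℂ)]
  | 1, 0 => ![1 / (Real.sqrt 2 : ℂ), -(1 / (Real.sqrt 2 : ℂ))]

/-- The `n`-qubit state `|E(s,t)⟩ = ⨂ₐ |α_{C(s)ₐ D(t)ₐ}⟩`, as the vector of its amplitudes in the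
computational basis, which is indexed by `{0,1}^n`. -/
def otmState {k n : ℕ} (C D : Code k n) (s t : BitString k) : BitString n → ℂ :=
  fun x => ∏ i, alphaState (C s i) (D t i) (x i)

/-! ### One-pass LOCC strategies -/

/-- The outcomes `z_{<a}` of the steps before step `a`. -/
def history {n q : ℕ} (z : Fin n → Fin q) (a : Fin n) : Fin a.val → Fin q :=
  fun i => z (Fin.castLE a.isLt.le i)

/-- A 1-pass LOCC measurement strategy on `n` isolated qubits with `q`-outcome measurements: it has
`n` steps; at step `a`, given the earlier outcomes `z_{<a}`, it picks the qubit `qubit a z_{<a}` and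
a POVM `povm a z_{<a}` on that qubit. No qubit is measured twice. POVM elements may vanish, so
that measurements with fewer outcomes, and skipping a qubit, are included. -/
structure OnePassLOCC (n q : ℕ) where
  qubit : (a : Fin n) → (Fin a.val → Fin q) → Fin n
  povm : (a : Fin n) → (Fin a.val → Fin q) → Fin q → Matrix (Fin 2) (Fin 2) ℂ
  posSemidef : ∀ a h ζ, (povm a h ζ).PosSemidef
  sum_eq_one : ∀ a h, ∑ ζ, povm a h ζ = 1
  measured_once : ∀ z : Fin n → Fin q, Function.Injective fun a => qubit a (history z a)

namespace OnePassLOCC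

variable {n q : ℕ}

/-- The `n`-qubit POVM element `M(z) = ⨂ₐ Mₐ(z_{≤a})`, where `Mₐ(z_{≤a})` acts on the qubit
chosen at step `a`, as a matrix in the computational basis. -/
def operator (M : OnePassLOCC n q) (z : Fin n → Fin q) : Matrix (BitString n) (BitString n) ℂ :=
  Matrix.of fun x y => ∏ a, M.povm a (history z a) (z a)
    (x (M.qubit a (history z a))) (y (M.qubit a (history z a)))

/-- The probability `⟨ψ|M(z)|ψ⟩` of the output `z` on the state `|ψ⟩`. -/
def outcomeProb (M : OnePassLOCC n q) (ψ : BitString n → ℂ) (z : Fin n → Fin q) : ℝ :=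
  (star ψ ⬝ᵥ (M.operator z *ᵥ ψ)).re

/-- The joint distribution `Pr[Z=z, (S,T)=(s,t)]`, where `S`, `T` are independent and uniform on
`{0,1}^k` and `Z` is the output of the strategy on the state `|E(S,T)⟩`. -/
def jointProb {k : ℕ} (M : OnePassLOCC n q) (C D : Code k n) (z : Fin n → Fin q)
    (st : BitString k × BitString k) : ℝ :=
  M.outcomeProb (otmState C D st.1 st.2) z / 4 ^ k

/-- `I(Z;S,T)`. -/
def infoGain {k : ℕ} (M : OnePassLOCC n q) (C D : Code k n) : ℝ :=
  mutualInfo fun z st => M.jointProb C D z st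

/-- `H(S,T|Z)`. -/
def remainingEntropy {k : ℕ} (M : OnePassLOCC n q) (C D : Code k n) : ℝ :=
  condEntropy fun st z => M.jointProb C D z st

end OnePassLOCC

/-! ### Random codes and the rate -/

/-- Probability of an event over the choice of independent random codes `C`, `D`, all of whose
values are independent and uniform, that is, over a uniformly random pair of functions. -/
def codeProb {k n : ℕ} (P : Code k n → Code k n → Prop) : ℝ :=
  (ProbabilityTheory.uniformOn (Set.univ : Set (Code k n × Code k n))).real {CD | P CD.1 CD.2}

/-- The capacity `1 - h(p_e) ≈ 0.3991` of the binary symmetric channel with error probability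
`p_e = sin²(π/8)`. `Real.binEntropy` is in nats. -/
def bscCapacity : ℝ := 1 - Real.binEntropy (Real.sin (Real.pi / 8) ^ 2) / Real.log 2

end

/-! Measure each step against the outcome law of the maximally mixed state. The information gained
is at most the sum over steps of the expected divergence from that reference
(`mutualInfo_uniform_le`, `sum_pathProd_mul_logb_le`). No step contributes more than one bit. The
point is that a step preceded by at most `2 * m` measurements contributes at most `3 / 5`, where `m`
is just below `k`.

The four states satisfy `|α₀₀⟩⟨α₀₀| + |α₁₁⟩⟨α₁₁| = |α₀₁⟩⟨α₀₁| + |α₁₀⟩⟨α₁₀|`, so every response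
splits as `p c + q d` with nonnegative parts (`IsQubitResponse.exists_decomposition`). Expanding the
product over the earlier steps gives a nonnegative combination of events, each fixing some bits `J`
of `C s` and `J'` of `D t` with `J.card + J'.card ≤ 2 * m`. One of the two sets has at most `m`
elements, and for a balanced code the next bit on that side is still nearly uniform. An uncertainty
relation (`sum_mul_logb_add_le`) bounds the divergence summed over that bit by `20 / 17`, whatever
the other bit is, and `51 / 100 * (20 / 17) = 3 / 5` (`sum_codeFiber_prod_mul_le`).

Hence the gain is at most `max (3 / 5 * n) (n - 4 / 5 * m)` (`infoGain_le`). With `m = k - n / 100`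
and `k ≥ 0.375 * n` this is below `1.9190 * k` with no correction term. Balancedness is a Chernoff
bound on fibers of expected size at least `2 ^ (n / 100)`, so the failure probability is doubly
exponentially small and survives a union bound over `2 * n * 4 ^ n` events
(`card_not_isBalanced_le`). -/

noncomputable section

/-! ### Single-qubit responses and the product form of outcome probabilities -/

/-- The probability of the POVM element `P` on the state `|α_{cd}⟩`. -/
def response (P : Matrix (Fin 2) (Fin 2) ℂ) (c d : Fin 2) : ℝ :=
  (star (alphaState c d) ⬝ᵥ (P *ᵥ alphaState c d)).re

/-- The probability of the POVM element `P` on the maximally mixed state. -/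
def weight (P : Matrix (Fin 2) (Fin 2) ℂ) : ℝ := P.trace.re / 2

lemma response_complex {P : Matrix (Fin 2) (Fin 2) ℂ} (hP : P.PosSemidef) (c d : Fin 2) :
    star (alphaState c d) ⬝ᵥ (P *ᵥ alphaState c d) = (response P c d : ℂ) := by
  have h := hP.dotProduct_mulVec_nonneg (alphaState c d)
  rw [Complex.le_def] at h
  apply Complex.ext
  · simp [response]
  · simpa using h.2.symm

lemma response_nonneg {P : Matrix (Fin 2) (Fin 2) ℂ} (hP : P.PosSemidef) (c d : Fin 2) :
    0 ≤ response P c d := by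
  have h := hP.dotProduct_mulVec_nonneg (alphaState c d)
  rw [response_complex hP] at h
  exact_mod_cast h

lemma inv_sqrt_two_sq : ((Real.sqrt 2 : ℝ) : ℂ)⁻¹ * ((Real.sqrt 2 : ℝ) : ℂ)⁻¹ = 1 / 2 := by
  rw [← mul_inv, ← Complex.ofReal_mul, Real.mul_self_sqrt (by norm_num)]
  norm_num

lemma response_zero_zero (P : Matrix (Fin 2) (Fin 2) ℂ) : response P 0 0 = (P 0 0).re := by
  simp [response, alphaState, Matrix.mulVec, dotProduct, Fin.sum_univ_two]

lemma response_one_one (P : Matrix (Fin 2) (Fin 2) ℂ) : response P 1 1 = (P 1 1).re := by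
  simp [response, alphaState, Matrix.mulVec, dotProduct, Fin.sum_univ_two]

lemma response_zero_one (P : Matrix (Fin 2) (Fin 2) ℂ) :
    response P 0 1 = ((P 0 0).re + (P 0 1).re + (P 1 0).re + (P 1 1).re) / 2 := by
  have h : star (alphaState 0 1) ⬝ᵥ (P *ᵥ alphaState 0 1)
      = (P 0 0 + P 0 1 + P 1 0 + P 1 1) * (1 / 2) := by
    rw [← inv_sqrt_two_sq]
    simp [alphaState, Matrix.mulVec, dotProduct, Fin.sum_univ_two]
    ring
  rw [response, h]
  simp
  ring

lemma response_one_zero (P : Matrix (Fin 2) (Fin 2) ℂ) :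
    response P 1 0 = ((P 0 0).re - (P 0 1).re - (P 1 0).re + (P 1 1).re) / 2 := by
  have h : star (alphaState 1 0) ⬝ᵥ (P *ᵥ alphaState 1 0)
      = (P 0 0 - P 0 1 - P 1 0 + P 1 1) * (1 / 2) := by
    rw [← inv_sqrt_two_sq]
    simp [alphaState, Matrix.mulVec, dotProduct, Fin.sum_univ_two]
    ring
  rw [response, h]
  simp
  ring

lemma weight_eq (P : Matrix (Fin 2) (Fin 2) ℂ) : weight P = ((P 0 0).re + (P 1 1).re) / 2 := by
  simp [weight, Matrix.trace_fin_two]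

lemma sum_response {ι : Type*} [Fintype ι] {P : ι → Matrix (Fin 2) (Fin 2) ℂ}
    (hP : ∑ ζ, P ζ = 1) (c d : Fin 2) : ∑ ζ, response (P ζ) c d = 1 := by
  have h : ∀ i j, ∑ ζ, (P ζ i j).re = ((1 : Matrix (Fin 2) (Fin 2) ℂ) i j).re := fun i j => by
    rw [← hP, Matrix.sum_apply, Complex.re_sum]
  fin_cases c <;> fin_cases d <;>
    simp [response_zero_zero, response_zero_one, response_one_zero, response_one_one,
      ← Finset.sum_div, Finset.sum_add_distrib, Finset.sum_sub_distrib, h]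

lemma sum_weight {ι : Type*} [Fintype ι] {P : ι → Matrix (Fin 2) (Fin 2) ℂ}
    (hP : ∑ ζ, P ζ = 1) : ∑ ζ, weight (P ζ) = 1 := by
  have h : ∀ i j, ∑ ζ, (P ζ i j).re = ((1 : Matrix (Fin 2) (Fin 2) ℂ) i j).re := fun i j => by
    rw [← hP, Matrix.sum_apply, Complex.re_sum]
  simp [weight_eq, ← Finset.sum_div, Finset.sum_add_distrib, h]

/-- What the argument uses about the outcome probabilities `f c d` of a POVM element on the states
`|α_{cd}⟩` and its weight `w`: the four numbers come from a Bloch vector in the unit ball. -/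
structure IsQubitResponse (f : Fin 2 → Fin 2 → ℝ) (w : ℝ) : Prop where
  nonneg : ∀ c d, 0 ≤ f c d
  weight_nonneg : 0 ≤ w
  sum_diag : f 0 0 + f 1 1 = 2 * w
  sum_offdiag : f 0 1 + f 1 0 = 2 * w
  sq_le_row : ∀ c, (f c 0 - w) ^ 2 + (f c 1 - w) ^ 2 ≤ w ^ 2
  sq_le_col : ∀ d, (f 0 d - w) ^ 2 + (f 1 d - w) ^ 2 ≤ w ^ 2

/-- The differences from the weight are, up to sign, the entries `(P₀₀ - P₁₁) / 2` and `Re P₀₁`, so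
the quadratic bounds amount to `(Re P₀₁)² ≤ P₀₀ P₁₁`, a consequence of `det P ≥ 0`. -/
lemma isQubitResponse_response {P : Matrix (Fin 2) (Fin 2) ℂ} (hP : P.PosSemidef) :
    IsQubitResponse (response P) (weight P) := by
  have h00 := response_nonneg hP 0 0
  have h11 := response_nonneg hP 1 1
  rw [response_zero_zero] at h00
  rw [response_one_one] at h11
  have hH : P 1 0 = star (P 0 1) := (hP.isHermitian.apply 1 0).symm
  have him0 : (P 0 0).im = 0 := by
    have := congrArg Complex.im (hP.isHermitian.apply 0 0); simp at this; linarith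
  have him1 : (P 1 1).im = 0 := by
    have := congrArg Complex.im (hP.isHermitian.apply 1 1); simp at this; linarith
  have hdet : (P 0 1).re ^ 2 ≤ (P 0 0).re * (P 1 1).re := by
    have h := hP.det_nonneg
    rw [Matrix.det_fin_two, Complex.le_def] at h
    have h1 := h.1
    simp [hH, him0, him1] at h1
    nlinarith [sq_nonneg (P 0 1).im]
  have hre : (P 1 0).re = (P 0 1).re := by rw [hH]; simp
  refine ⟨fun c d => response_nonneg hP c d, ?_, ?_, ?_, fun c => ?_, fun c => ?_⟩
  · rw [weight_eq]; linarith
  · rw [weight_eq, response_zero_zero, response_one_one]; ring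
  · rw [weight_eq, response_zero_one, response_one_zero]; ring
  all_goals
    fin_cases c <;>
    simp only [Fin.zero_eta, Fin.mk_one, response_zero_zero, response_zero_one, response_one_zero,
      response_one_one, weight_eq, hre] <;> nlinarith

/-- A product operator on a product state factorizes; the permutation, which turns measurement order
into qubit order, is absorbed by reindexing both sums over basis strings. -/
lemma star_dotProduct_mulVec_prod {n : ℕ} (Q : Equiv.Perm (Fin n)) (α : Fin n → Fin 2 → ℂ)
    (P : Fin n → Matrix (Fin 2) (Fin 2) ℂ) :
    star (fun x : BitString n => ∏ i, α i (x i)) ⬝ᵥ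
      ((Matrix.of fun x y : BitString n => ∏ a, P a (x (Q a)) (y (Q a))) *ᵥ
        fun x => ∏ i, α i (x i)) = ∏ a, star (α (Q a)) ⬝ᵥ (P a *ᵥ α (Q a)) := by
  have hterm : ∀ a, star (α (Q a)) ⬝ᵥ (P a *ᵥ α (Q a))
      = ∑ u, ∑ v, star (α (Q a) u) * (P a u v * α (Q a) v) := fun a => by
    simp only [dotProduct, Matrix.mulVec, Finset.mul_sum, Pi.star_apply]
  simp only [hterm]
  simp only [Finset.prod_univ_sum, Fintype.piFinset_univ]
  simp only [dotProduct, Matrix.mulVec, Matrix.of_apply, Finset.mul_sum, Pi.star_apply]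
  refine Fintype.sum_equiv (Equiv.arrowCongr Q.symm (Equiv.refl _)) _ _ fun x => ?_
  refine Fintype.sum_equiv (Equiv.arrowCongr Q.symm (Equiv.refl _)) _ _ fun y => ?_
  simp only [Equiv.arrowCongr_apply, Function.comp, Equiv.refl_apply, Equiv.symm_symm,
    Finset.prod_mul_distrib]
  rw [star_prod, ← Equiv.prod_comp Q (fun i => star (α i (x i))),
    ← Equiv.prod_comp Q (fun i => α i (y i))]

lemma OnePassLOCC.outcomeProb_otmState {n k : ℕ} (M : OnePassLOCC n 2) (C D : Code k n)
    (s t : BitString k) (z : Fin n → Fin 2) :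
    M.outcomeProb (otmState C D s t) z = ∏ a, response (M.povm a (history z a) (z a))
      (C s (M.qubit a (history z a))) (D t (M.qubit a (history z a))) := by
  let Q : Equiv.Perm (Fin n) := Equiv.ofBijective (fun a => M.qubit a (history z a))
    (Finite.injective_iff_bijective.1 (M.measured_once z))
  have h := star_dotProduct_mulVec_prod Q (fun i => alphaState (C s i) (D t i))
    (fun a => M.povm a (history z a) (z a))
  have h' : star (otmState C D s t) ⬝ᵥ (M.operator z *ᵥ otmState C D s t) =
      ((∏ a, response (M.povm a (history z a) (z a))
      (C s (M.qubit a (history z a))) (D t (M.qubit a (history z a))) : ℝ) : ℂ) := by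
    refine Eq.trans h ?_
    rw [Complex.ofReal_prod]
    exact Finset.prod_congr rfl fun a _ => response_complex (M.posSemidef _ _ _) _ _
  rw [OnePassLOCC.outcomeProb, h', Complex.ofReal_re]

/-! ### Adaptive processes and the chain rule for divergence -/

section Adaptive

variable {Ω : Type*} [Fintype Ω] {q : ℕ}

lemma history_castSucc_snoc {m : ℕ} (z : Fin m → Fin q) (ζ : Fin q) (a : Fin m) :
    history (n := m + 1) (Fin.snoc z ζ) a.castSucc = history z a := by
  funext i
  exact Fin.snoc_castSucc (α := fun _ => Fin q) ζ z (Fin.castLE a.isLt.le i)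

lemma history_last_snoc {m : ℕ} (z : Fin m → Fin q) (ζ : Fin q) :
    history (n := m + 1) (Fin.snoc z ζ) (Fin.last m) = z := by
  funext i
  exact Fin.snoc_castSucc (α := fun _ => Fin q) ζ z i

/-- The product along the path `z` of quantities depending on the history and the outcome. -/
def pathProd {m : ℕ} (f : (a : Fin m) → (Fin a.val → Fin q) → Fin q → ℝ) (z : Fin m → Fin q) : ℝ :=
  ∏ a, f a (history z a) (z a)

/-- The restriction of an adaptive process to the steps before step `a`. -/
def stepsBefore {m : ℕ} (f : (a : Fin m) → (Fin a.val → Fin q) → Fin q → ℝ) (a : Fin m) :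
    (b : Fin a.val) → (Fin b.val → Fin q) → Fin q → ℝ :=
  fun b => f (Fin.castLE a.isLt.le b)

lemma pathProd_snoc {m : ℕ} (f : (a : Fin (m + 1)) → (Fin a.val → Fin q) → Fin q → ℝ)
    (z : Fin m → Fin q) (ζ : Fin q) :
    pathProd f (Fin.snoc z ζ : Fin (m + 1) → Fin q)
      = pathProd (stepsBefore f (Fin.last m)) z * f (Fin.last m) z ζ := by
  unfold pathProd
  rw [Fin.prod_univ_castSucc]
  congr 1
  · refine Finset.prod_congr rfl fun a _ => ?_
    rw [history_castSucc_snoc, Fin.snoc_castSucc]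
    rfl
  · rw [history_last_snoc, Fin.snoc_last]

lemma sum_path_succ {m : ℕ} (F : (Fin (m + 1) → Fin q) → ℝ) :
    ∑ z, F z = ∑ z : Fin m → Fin q, ∑ ζ, F (Fin.snoc z ζ : Fin (m + 1) → Fin q) := by
  rw [← Fintype.sum_prod_type', ← (Fin.snocEquiv fun _ : Fin (m + 1) => Fin q).sum_comp,
    ← (Equiv.prodComm _ _).sum_comp]
  rfl

lemma sum_pathProd {m : ℕ} (f : (a : Fin m) → (Fin a.val → Fin q) → Fin q → ℝ)
    (hf : ∀ a h, ∑ ζ, f a h ζ = 1) : ∑ z, pathProd f z = 1 := by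
  induction m with
  | zero => simp [pathProd]
  | succ m ih =>
    rw [sum_path_succ]
    simp only [pathProd_snoc, ← Finset.mul_sum, hf, mul_one]
    exact ih _ fun a h => hf a.castSucc h

/-- Chain rule: the divergence of an adaptive process from a reference process is bounded by the
sum of bounds on the expected divergences of its steps. -/
theorem sum_pathProd_mul_logb_le {m : ℕ}
    (f : (a : Fin m) → (Fin a.val → Fin q) → Fin q → Ω → ℝ)
    (w : (a : Fin m) → (Fin a.val → Fin q) → Fin q → ℝ) (K : Fin m → ℝ)
    (hf : ∀ a h ω, ∑ ζ, f a h ζ ω = 1) (hfw : ∀ a h ζ ω, w a h ζ = 0 → f a h ζ ω = 0)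
    (hK : ∀ a (h : Fin a.val → Fin q),
      ∑ ω, pathProd (stepsBefore (fun a h ζ => f a h ζ ω) a) h *
          ∑ ζ, f a h ζ ω * Real.logb 2 (f a h ζ ω / w a h ζ)
        ≤ K a * ∑ ω, pathProd (stepsBefore (fun a h ζ => f a h ζ ω) a) h) :
    ∑ z, ∑ ω, pathProd (fun a h ζ => f a h ζ ω) z *
        Real.logb 2 (pathProd (fun a h ζ => f a h ζ ω) z / pathProd w z)
      ≤ (∑ a, K a) * Fintype.card Ω := by
  induction m with
  | zero => simp [pathProd]
  | succ m ih =>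
    have ih' := ih (fun a => f a.castSucc) (fun a => w a.castSucc) (fun a => K a.castSucc)
      (fun a h ω => hf a.castSucc h ω) (fun a h ζ ω => hfw a.castSucc h ζ ω) (fun a h => hK a.castSucc h)
    have hlast : ∑ z : Fin m → Fin q,
        ∑ ω, pathProd (stepsBefore (fun a h ζ => f a h ζ ω) (Fin.last m)) z *
          ∑ ζ, f (Fin.last m) z ζ ω * Real.logb 2 (f (Fin.last m) z ζ ω / w (Fin.last m) z ζ)
        ≤ K (Fin.last m) * Fintype.card Ω := by
      refine (Finset.sum_le_sum fun z _ => hK (Fin.last m) z).trans (le_of_eq ?_)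
      rw [← Finset.mul_sum, Finset.sum_comm]
      congr 1
      rw [Finset.sum_congr rfl fun ω _ => sum_pathProd
        (stepsBefore (fun a h ζ => f a h ζ ω) (Fin.last m)) fun a h => hf (Fin.castLE (Fin.last m).isLt.le a) h ω]
      simp
    rw [Fin.sum_univ_castSucc, add_mul]
    refine le_trans (le_of_eq ?_) (add_le_add ih' hlast)
    rw [sum_path_succ, ← Finset.sum_add_distrib]
    refine Finset.sum_congr rfl fun z _ => ?_
    rw [Finset.sum_comm, ← Finset.sum_add_distrib]
    refine Finset.sum_congr rfl fun ω _ => ?_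
    simp only [pathProd_snoc]
    set P := pathProd (stepsBefore (fun a h ζ => f a h ζ ω) (Fin.last m)) z with hP
    set W := pathProd (stepsBefore w (Fin.last m)) z with hW
    have e1 : pathProd (fun (a : Fin m) h ζ => f a.castSucc h ζ ω) z = P := rfl
    have e2 : pathProd (fun (a : Fin m) => w a.castSucc) z = W := rfl
    rw [e1, e2]
    -- Absolute continuity passes to products, so the logarithm of the ratio can be split wherever
    -- the path has positive probability.
    have hPW : W = 0 → P = 0 := fun h => by
      obtain ⟨a, -, ha⟩ := Finset.prod_eq_zero_iff.1 h
      exact Finset.prod_eq_zero (Finset.mem_univ a) (hfw _ _ _ _ ha)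
    rcases eq_or_ne P 0 with hP0 | hP0
    · simp [hP0]
    have hW0 : W ≠ 0 := fun h => hP0 (hPW h)
    have key : ∀ ζ, P * f (Fin.last m) z ζ ω * Real.logb 2
        (P * f (Fin.last m) z ζ ω / (W * w (Fin.last m) z ζ))
        = f (Fin.last m) z ζ ω * (P * Real.logb 2 (P / W)) +
          P * (f (Fin.last m) z ζ ω * Real.logb 2 (f (Fin.last m) z ζ ω / w (Fin.last m) z ζ)) := by
      intro ζ
      rcases eq_or_ne (f (Fin.last m) z ζ ω) 0 with h0 | h0
      · simp [h0]
      have hw0 : w (Fin.last m) z ζ ≠ 0 := fun h => h0 (hfw _ _ _ _ h)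
      rw [mul_div_mul_comm, Real.logb_mul (div_ne_zero hP0 hW0) (div_ne_zero h0 hw0)]
      ring
    rw [Finset.sum_congr rfl fun ζ _ => key ζ, Finset.sum_add_distrib, ← Finset.sum_mul, hf,
      one_mul, Finset.mul_sum]

end Adaptive

/-! ### Divergence of one qubit measurement and the uncertainty relation -/

/-- The Gibbs inequality in bits. -/
lemma sum_mul_logb_div_nonneg {ι : Type*} [Fintype ι] {p w : ι → ℝ} (hp : ∀ i, 0 ≤ p i)
    (hw : ∀ i, 0 ≤ w i) (hpw : ∀ i, w i = 0 → p i = 0) (hle : ∑ i, w i ≤ ∑ i, p i) :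
    0 ≤ ∑ i, p i * Real.logb 2 (p i / w i) := by
  have h2 : 0 < Real.log 2 := Real.log_pos one_lt_two
  have key : ∀ i, (p i - w i) / Real.log 2 ≤ p i * Real.logb 2 (p i / w i) := by
    intro i
    rcases eq_or_ne (p i) 0 with h0 | h0
    · simp only [h0, zero_mul, zero_sub]
      exact div_nonpos_of_nonpos_of_nonneg (neg_nonpos.2 (hw i)) h2.le
    have hp0 := lt_of_le_of_ne (hp i) (Ne.symm h0)
    have hw0 : 0 < w i := lt_of_le_of_ne (hw i) fun h => h0 (hpw i h.symm)
    rw [Real.logb, ← mul_div_assoc]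
    refine div_le_div_of_nonneg_right ?_ h2.le
    have h := Real.one_sub_inv_le_log_of_pos (div_pos hp0 hw0)
    calc p i - w i = p i * (1 - (p i / w i)⁻¹) := by field_simp
      _ ≤ _ := mul_le_mul_of_nonneg_left h (hp i)
  refine le_trans ?_ (Finset.sum_le_sum fun i _ => key i)
  rw [← Finset.sum_div, Finset.sum_sub_distrib]
  exact div_nonneg (sub_nonneg.2 hle) h2.le

/-- The divergence between the outcome distributions of a qubit measurement on `|α_{cd}⟩` and on
the maximally mixed state. -/
def stepDivergence {ι : Type*} [Fintype ι] (f : ι → Fin 2 → Fin 2 → ℝ) (w : ι → ℝ)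
    (c d : Fin 2) : ℝ :=
  ∑ ζ, f ζ c d * Real.logb 2 (f ζ c d / w ζ)

namespace IsQubitResponse

variable {f : Fin 2 → Fin 2 → ℝ} {w : ℝ}

lemma le_two_mul (h : IsQubitResponse f w) (c d : Fin 2) : f c d ≤ 2 * w := by
  have h1 := h.sum_diag
  have h2 := h.sum_offdiag
  have h00 := h.nonneg 0 0
  have h01 := h.nonneg 0 1
  have h10 := h.nonneg 1 0
  have h11 := h.nonneg 1 1
  fin_cases c <;> fin_cases d <;> simp <;> linarith

lemma eq_zero_of_weight (h : IsQubitResponse f w) (hw : w = 0) (c d : Fin 2) : f c d = 0 :=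
  le_antisymm (by simpa [hw] using h.le_two_mul c d) (h.nonneg c d)

/-- A qubit response is a nonnegative combination of the responses that read off one of the two
encoded bits exactly. -/
lemma exists_decomposition (h : IsQubitResponse f w) :
    ∃ p q : Fin 2 → ℝ, (∀ e, 0 ≤ p e) ∧ (∀ e, 0 ≤ q e) ∧ ∀ c d, f c d = p c + q d := by
  have h1 := h.sum_diag
  have h2 := h.sum_offdiag
  have h00 := h.nonneg 0 0
  have h01 := h.nonneg 0 1
  have h10 := h.nonneg 1 0
  have h11 := h.nonneg 1 1
  -- The two diagonal sums agree, so `f 1 d - f 0 d` does not depend on `d`: one row is smaller in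
  -- both columns. That row serves as `q`, and `p` carries the excess.
  rcases le_total (f 0 0) (f 1 0) with hle | hle
  · refine ⟨![0, f 1 0 - f 0 0], ![f 0 0, f 0 1], ?_, ?_, ?_⟩
    · simp only [Fin.forall_fin_two, Matrix.cons_val_zero, Matrix.cons_val_one]
      constructor <;> linarith
    · simp only [Fin.forall_fin_two, Matrix.cons_val_zero, Matrix.cons_val_one]
      constructor <;> linarith
    · intro c d; fin_cases c <;> fin_cases d <;> simp <;> linarith
  · refine ⟨![f 0 0 - f 1 0, 0], ![f 1 0, f 1 1], ?_, ?_, ?_⟩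
    · simp only [Fin.forall_fin_two, Matrix.cons_val_zero, Matrix.cons_val_one]
      constructor <;> linarith
    · simp only [Fin.forall_fin_two, Matrix.cons_val_zero, Matrix.cons_val_one]
      constructor <;> linarith
    · intro c d; fin_cases c <;> fin_cases d <;> simp <;> linarith

end IsQubitResponse

section StepDivergence

variable {ι : Type*} [Fintype ι] {f : ι → Fin 2 → Fin 2 → ℝ} {w : ι → ℝ}

lemma stepDivergence_nonneg (h : ∀ ζ, IsQubitResponse (f ζ) (w ζ))
    (hf : ∀ c d, ∑ ζ, f ζ c d = 1) (hw : ∑ ζ, w ζ = 1) (c d : Fin 2) :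
    0 ≤ stepDivergence f w c d :=
  sum_mul_logb_div_nonneg (fun ζ => (h ζ).nonneg c d) (fun ζ => (h ζ).weight_nonneg)
    (fun ζ hζ => (h ζ).eq_zero_of_weight hζ c d) (by rw [hf, hw])

/-- Each likelihood ratio is at most `2`, by `IsQubitResponse.le_two_mul`. -/
lemma stepDivergence_le_one (h : ∀ ζ, IsQubitResponse (f ζ) (w ζ))
    (hf : ∀ c d, ∑ ζ, f ζ c d = 1) (c d : Fin 2) : stepDivergence f w c d ≤ 1 := by
  rw [← hf c d]
  refine Finset.sum_le_sum fun ζ _ => ?_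
  rcases eq_or_ne (f ζ c d) 0 with h0 | h0
  · simp [h0]
  have hpos := lt_of_le_of_ne ((h ζ).nonneg c d) (Ne.symm h0)
  have hw0 : 0 < w ζ := lt_of_le_of_ne (h ζ).weight_nonneg fun h' =>
    h0 ((h ζ).eq_zero_of_weight h'.symm c d)
  refine mul_le_of_le_one_right hpos.le ?_
  rw [Real.logb_le_iff_le_rpow one_lt_two (div_pos hpos hw0), Real.rpow_one, div_le_iff₀ hw0]
  exact (h ζ).le_two_mul c d

/-- The uncertainty relation: neighbouring states lie on orthogonal axes of the Bloch sphere, so no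
measurement is informative about both. The disc condition reads `p² + r² ≤ 2 * w * (p + r) - w²`;
dividing by `w` and summing gives `∑ (p² + r²) / w ≤ 3`. By concavity of the logarithm the two
divergences then sum to at most `2 * logb 2 (3 / 2)`. -/
lemma sum_mul_logb_add_le {p r w : ι → ℝ} (hp : ∀ i, 0 ≤ p i) (hr : ∀ i, 0 ≤ r i)
    (hw : ∀ i, 0 ≤ w i) (hsq : ∀ i, (p i - w i) ^ 2 + (r i - w i) ^ 2 ≤ w i ^ 2)
    (hp1 : ∑ i, p i = 1) (hr1 : ∑ i, r i = 1) (hw1 : ∑ i, w i = 1) :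
    ∑ i, p i * Real.logb 2 (p i / w i) + ∑ i, r i * Real.logb 2 (r i / w i)
      ≤ 2 * Real.logb 2 (3 / 2) := by
  have h2 : 0 < Real.log 2 := Real.log_pos one_lt_two
  -- Jensen's inequality in tangent form, at the point `3 / 2`, the mean of the two second moments
  -- `∑ p² / w` and `∑ r² / w` at the extreme value `3`.
  have tangent : ∀ x v : ℝ, 0 ≤ x → 0 < v →
      x * Real.log (x / v) ≤ x ^ 2 / (3 / 2 * v) - x + x * Real.log (3 / 2) := by
    intro x v hx hv
    rcases hx.eq_or_lt with rfl | hx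
    · simp
    have h := Real.log_le_sub_one_of_pos (show 0 < x / v / (3 / 2) by positivity)
    rw [Real.log_div (by positivity) (by norm_num)] at h
    have h' := mul_le_mul_of_nonneg_left h hx.le
    have e : x * (x / v / (3 / 2) - 1) = x ^ 2 / (3 / 2 * v) - x := by field_simp
    linarith
  have key : ∀ i, p i * Real.log (p i / w i) + r i * Real.log (r i / w i) ≤
      (p i + r i) * (1 / 3 + Real.log (3 / 2)) - 2 / 3 * w i := by
    intro i
    rcases (hw i).eq_or_lt with h0 | h0
    · have h := hsq i
      rw [← h0] at h ⊢
      have hp0 : p i = 0 := by nlinarith [sq_nonneg (p i), sq_nonneg (r i)]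
      have hr0 : r i = 0 := by nlinarith [sq_nonneg (p i), sq_nonneg (r i)]
      simp [hp0, hr0]
    have h1 := tangent _ _ (hp i) h0
    have h3 := tangent _ _ (hr i) h0
    have h4 : p i ^ 2 / (3 / 2 * w i) + r i ^ 2 / (3 / 2 * w i) ≤
        4 / 3 * (p i + r i) - 2 / 3 * w i := by
      rw [← add_div, div_le_iff₀ (by positivity)]
      nlinarith [hsq i]
    linarith
  have hsum := Finset.sum_le_sum fun i (_ : i ∈ Finset.univ) => key i
  simp only [Finset.sum_add_distrib, Finset.sum_sub_distrib, ← Finset.sum_mul, ← Finset.mul_sum,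
    hp1, hr1, hw1] at hsum
  simp only [Real.logb, ← mul_div_assoc, ← Finset.sum_div, ← add_div]
  refine div_le_div_of_nonneg_right ?_ h2.le
  linarith

lemma logb_two_three_halves_le : Real.logb 2 (3 / 2) ≤ 10 / 17 := by
  rw [Real.logb_le_iff_le_rpow one_lt_two (by norm_num)]
  -- The claim becomes `(3 / 2) ^ 17 ≤ 2 ^ 10`.
  refine le_of_pow_le_pow_left₀ (n := 17) (by norm_num) (by positivity) ?_
  rw [← Real.rpow_natCast (2 ^ (10 / 17 : ℝ)) 17, ← Real.rpow_mul (by norm_num)]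
  norm_num

lemma stepDivergence_row_le (h : ∀ ζ, IsQubitResponse (f ζ) (w ζ))
    (hf : ∀ c d, ∑ ζ, f ζ c d = 1) (hw : ∑ ζ, w ζ = 1) (c : Fin 2) :
    stepDivergence f w c 0 + stepDivergence f w c 1 ≤ 20 / 17 := by
  have := sum_mul_logb_add_le (fun ζ => (h ζ).nonneg c 0) (fun ζ => (h ζ).nonneg c 1)
    (fun ζ => (h ζ).weight_nonneg) (fun ζ => (h ζ).sq_le_row c) (hf c 0) (hf c 1) hw
  have h2 := logb_two_three_halves_le
  unfold stepDivergence
  linarith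

lemma stepDivergence_col_le (h : ∀ ζ, IsQubitResponse (f ζ) (w ζ))
    (hf : ∀ c d, ∑ ζ, f ζ c d = 1) (hw : ∑ ζ, w ζ = 1) (d : Fin 2) :
    stepDivergence f w 0 d + stepDivergence f w 1 d ≤ 20 / 17 := by
  have := sum_mul_logb_add_le (fun ζ => (h ζ).nonneg 0 d) (fun ζ => (h ζ).nonneg 1 d)
    (fun ζ => (h ζ).weight_nonneg) (fun ζ => (h ζ).sq_le_col d) (hf 0 d) (hf 1 d) hw
  have h2 := logb_two_three_halves_le
  unfold stepDivergence
  linarith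

end StepDivergence

/-! ### Balanced codes and the information in one further qubit -/

section Balanced

variable {k n : ℕ}

/-- The bit strings that agree with `x` on `J`. -/
def subcube (J : Finset (Fin n)) (x : BitString n) : Finset (BitString n) :=
  Finset.univ.filter fun y => ∀ j ∈ J, y j = x j

/-- The messages whose codeword agrees with `x` on `J`. -/
def codeFiber (C : Code k n) (J : Finset (Fin n)) (x : BitString n) : Finset (BitString k) :=
  Finset.univ.filter fun s => C s ∈ subcube J x

/-- Given any `m` bits of the codeword, each further bit is close to uniform. -/
def IsBalanced (m : ℕ) (C : Code k n) : Prop :=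
  ∀ J : Finset (Fin n), J.card ≤ m → ∀ x, ∀ i ∉ J, ∀ e,
    (((codeFiber C J x).filter fun s => C s i = e).card : ℝ) ≤ 51 / 100 * (codeFiber C J x).card

lemma subcube_insert_update {J : Finset (Fin n)} {i : Fin n} (hi : i ∉ J) (x : BitString n)
    (e : Fin 2) :
    subcube (insert i J) (Function.update x i e) = (subcube J x).filter fun y => y i = e := by
  ext y
  simp only [subcube, Finset.mem_filter, Finset.mem_univ, true_and, Finset.forall_mem_insert,
    Function.update_self]
  rw [and_comm]
  refine and_congr_left fun _ => forall₂_congr fun j hj => ?_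
  rw [Function.update_of_ne (ne_of_mem_of_not_mem hj hi)]

lemma codeFiber_insert_update (C : Code k n) {J : Finset (Fin n)} {i : Fin n} (hi : i ∉ J)
    (x : BitString n) (e : Fin 2) :
    codeFiber C (insert i J) (Function.update x i e)
      = (codeFiber C J x).filter fun s => C s i = e := by
  ext s
  simp [codeFiber, subcube_insert_update hi]

lemma sum_comp_mul_eq {α : Type*} (A : Finset α) (φ : α → Fin 2) (p : Fin 2 → ℝ) (Y : α → ℝ) :
    ∑ s ∈ A, p (φ s) * Y s = ∑ e, p e * ∑ s ∈ A.filter (fun s => φ s = e), Y s := by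
  rw [← Finset.sum_fiberwise A φ]
  refine Finset.sum_congr rfl fun e _ => ?_
  rw [Finset.mul_sum]
  exact Finset.sum_congr rfl fun s hs => by rw [(Finset.mem_filter.1 hs).2]

lemma sum_le_of_balanced {α : Type*} (A : Finset α) (φ : α → Fin 2)
    (hA : ∀ e, ((A.filter fun s => φ s = e).card : ℝ) ≤ 51 / 100 * A.card) (G : Fin 2 → ℝ)
    (hG : ∀ e, 0 ≤ G e) (hG' : G 0 + G 1 ≤ 20 / 17) : ∑ s ∈ A, G (φ s) ≤ 3 / 5 * A.card := by
  have h := sum_comp_mul_eq A φ G fun _ => 1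
  simp only [mul_one, Finset.sum_const, nsmul_eq_mul, Fin.sum_univ_two] at h
  rw [h]
  have h0 := mul_le_mul_of_nonneg_left (hA 0) (hG 0)
  have h1 := mul_le_mul_of_nonneg_left (hA 1) (hG 1)
  have h2 := mul_le_mul_of_nonneg_right hG' (Nat.cast_nonneg (α := ℝ) A.card)
  linarith

variable {C D : Code k n} {m : ℕ} {g : Fin 2 → Fin 2 → ℝ}

/-- The budget forces `J.card ≤ m` or `J'.card ≤ m`. The message on the other side is held fixed,
and balance is applied to the short side with the matching row or column bound. -/
lemma sum_codeFiber_le (hC : IsBalanced m C) (hD : IsBalanced m D) {i : Fin n}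
    (hg : ∀ c d, 0 ≤ g c d) (hrow : ∀ c, g c 0 + g c 1 ≤ 20 / 17)
    (hcol : ∀ d, g 0 d + g 1 d ≤ 20 / 17) {J J' : Finset (Fin n)} (hJ : i ∉ J) (hJ' : i ∉ J')
    (hcard : J.card + J'.card ≤ 2 * m) (x x' : BitString n) :
    ∑ s ∈ codeFiber C J x, ∑ t ∈ codeFiber D J' x', (g (C s i) (D t i) - 3 / 5) ≤ 0 := by
  rcases le_or_gt J.card m with h | h
  · rw [Finset.sum_comm]
    refine Finset.sum_nonpos fun t _ => ?_
    have := sum_le_of_balanced _ (fun s => C s i) (hC J h x i hJ) (fun c => g c (D t i))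
      (fun c => hg _ _) (hcol _)
    simp only [Finset.sum_sub_distrib, Finset.sum_const, nsmul_eq_mul]
    linarith
  · refine Finset.sum_nonpos fun s _ => ?_
    have := sum_le_of_balanced _ (fun t => D t i) (hD J' (by omega) x' i hJ')
      (fun d => g (C s i) d) (fun d => hg _ _) (hrow _)
    simp only [Finset.sum_sub_distrib, Finset.sum_const, nsmul_eq_mul]
    linarith

/-- Induction on the measurements still to be expanded. Splitting a factor as `p c + q d` trades it
for one more fixed bit, added to `J` in the first term and to `J'` in the second, so `F.card +
J.card + J'.card` is preserved. Injectivity of `Q` keeps the new coordinate fresh. -/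
lemma sum_codeFiber_prod_mul_le {ι : Type*} (Q : ι → Fin n)
    (r : ι → Fin 2 → Fin 2 → ℝ) (hr : ∀ a, ∃ p q : Fin 2 → ℝ, (∀ e, 0 ≤ p e) ∧ (∀ e, 0 ≤ q e) ∧
      ∀ c d, r a c d = p c + q d) (hC : IsBalanced m C) (hD : IsBalanced m D) {i : Fin n}
    (hg : ∀ c d, 0 ≤ g c d) (hrow : ∀ c, g c 0 + g c 1 ≤ 20 / 17)
    (hcol : ∀ d, g 0 d + g 1 d ≤ 20 / 17) (F : Finset ι) :
    ∀ J J' : Finset (Fin n), i ∉ J → i ∉ J' → Set.InjOn Q F → (∀ a ∈ F, Q a ≠ i) →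
      (∀ a ∈ F, Q a ∉ J ∧ Q a ∉ J') → F.card + J.card + J'.card ≤ 2 * m → ∀ x x' : BitString n,
      ∑ s ∈ codeFiber C J x, ∑ t ∈ codeFiber D J' x',
        (∏ a ∈ F, r a (C s (Q a)) (D t (Q a))) * (g (C s i) (D t i) - 3 / 5) ≤ 0 := by
  classical
  induction F using Finset.induction_on with
  | empty =>
    intro J J' hJ hJ' _ _ _ hcard x x'
    simpa using sum_codeFiber_le hC hD hg hrow hcol hJ hJ' (by simpa using hcard) x x'
  | insert a F ha ih =>
    intro J J' hJ hJ' hinj hne hdisj hcard x x'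
    obtain ⟨p, q, hp, hq, hpq⟩ := hr a
    have haJ := hdisj a (Finset.mem_insert_self a F)
    have hai := hne a (Finset.mem_insert_self a F)
    rw [Finset.card_insert_of_notMem ha] at hcard
    have hinj' : Set.InjOn Q F := hinj.mono (by simp)
    have hne' : ∀ b ∈ F, Q b ≠ i := fun b hb => hne b (Finset.mem_insert_of_mem hb)
    have hQ : ∀ b ∈ F, Q b ≠ Q a := fun b hb h => ha <| by
      rw [← hinj (by simp [hb]) (by simp) h]; exact hb
    have hnotin : ∀ {I : Finset (Fin n)}, (∀ b ∈ F, Q b ∉ I) → ∀ b ∈ F, Q b ∉ insert (Q a) I :=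
      fun hI b hb => by simp [hQ b hb, hI b hb]
    have hFJ : ∀ b ∈ F, Q b ∉ J := fun b hb => (hdisj b (Finset.mem_insert_of_mem hb)).1
    have hFJ' : ∀ b ∈ F, Q b ∉ J' := fun b hb => (hdisj b (Finset.mem_insert_of_mem hb)).2
    simp only [Finset.prod_insert ha, hpq, add_mul, mul_assoc, Finset.sum_add_distrib]
    refine add_nonpos ?_ ?_
    · simp only [← Finset.mul_sum]
      rw [sum_comp_mul_eq _ (fun s => C s (Q a)) p]
      refine Finset.sum_nonpos fun e _ => mul_nonpos_of_nonneg_of_nonpos (hp e) ?_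
      rw [← codeFiber_insert_update C haJ.1]
      refine ih _ _ (by simp [hJ, hai.symm]) hJ' hinj' hne'
        (fun b hb => ⟨hnotin hFJ b hb, hFJ' b hb⟩) ?_ _ _
      rw [Finset.card_insert_of_notMem haJ.1]
      omega
    · rw [Finset.sum_comm]
      simp only [← Finset.mul_sum]
      rw [sum_comp_mul_eq _ (fun t => D t (Q a)) q]
      refine Finset.sum_nonpos fun e _ => mul_nonpos_of_nonneg_of_nonpos (hq e) ?_
      rw [← codeFiber_insert_update D haJ.2, Finset.sum_comm]
      refine ih _ _ hJ (by simp [hJ', hai.symm]) hinj' hne'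
        (fun b hb => ⟨hFJ b hb, hnotin hFJ' b hb⟩) ?_ _ _
      rw [Finset.card_insert_of_notMem haJ.2]
      omega

/-- If both codes are balanced, then the first `2 * m` qubits measured before qubit `i` leave its
state so uncertain that measuring it yields at most `3 / 5` of a bit on average. -/
lemma sum_prod_response_mul_le {ι : Type*} [Fintype ι] {Q : ι → Fin n} (hQ : Function.Injective Q)
    {r : ι → Fin 2 → Fin 2 → ℝ} (hr : ∀ a, ∃ p q : Fin 2 → ℝ, (∀ e, 0 ≤ p e) ∧ (∀ e, 0 ≤ q e) ∧
      ∀ c d, r a c d = p c + q d) (hC : IsBalanced m C) (hD : IsBalanced m D) {i : Fin n}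
    (hi : ∀ a, Q a ≠ i) (hg : ∀ c d, 0 ≤ g c d) (hrow : ∀ c, g c 0 + g c 1 ≤ 20 / 17)
    (hcol : ∀ d, g 0 d + g 1 d ≤ 20 / 17) (hcard : Fintype.card ι ≤ 2 * m) :
    ∑ st : BitString k × BitString k,
        (∏ a, r a (C st.1 (Q a)) (D st.2 (Q a))) * g (C st.1 i) (D st.2 i)
      ≤ 3 / 5 * ∑ st : BitString k × BitString k, ∏ a, r a (C st.1 (Q a)) (D st.2 (Q a)) := by
  have huniv : ∀ E : Code k n, codeFiber E ∅ 0 = Finset.univ := fun E => by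
    simp [codeFiber, subcube]
  have h := sum_codeFiber_prod_mul_le Q r hr hC hD hg hrow hcol Finset.univ ∅ ∅ (by simp)
    (by simp) hQ.injOn (fun a _ => hi a) (by simp) (by simpa using hcard) 0 0
  rw [huniv, huniv, ← Fintype.sum_prod_type'] at h
  simp only [mul_sub, Finset.sum_sub_distrib, ← Finset.sum_mul] at h
  linarith

end Balanced

/-! ### Random codes are balanced -/

section RandomCode

variable {k n : ℕ}

/-- Chernoff's method in counting form: the indicator of a positive sum is at most the exponential
of the sum, and the sum over all functions of a product of values factorizes. -/
lemma card_filter_sum_pos_le {S X : Type*} [Fintype S] [DecidableEq S] [Fintype X] (Y : X → ℝ)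
    [DecidablePred fun C : S → X => 0 < ∑ s, Y (C s)] :
    ((Finset.univ.filter fun C : S → X => 0 < ∑ s, Y (C s)).card : ℝ)
      ≤ (∑ x, Real.exp (Y x)) ^ Fintype.card S := by
  rw [← Finset.card_univ, ← Finset.prod_const, Finset.prod_univ_sum, Fintype.piFinset_univ,
    Finset.card_filter, Nat.cast_sum]
  refine Finset.sum_le_sum fun C _ => ?_
  rw [← Real.exp_sum]
  split_ifs with h
  · simpa using Real.one_le_exp h.le
  · simpa using Real.exp_nonneg _

lemma card_subcube (J : Finset (Fin n)) (x : BitString n) :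
    (subcube J x).card = 2 ^ (n - J.card) := by
  have h : subcube J x = Fintype.piFinset fun j => if j ∈ J then {x j} else Finset.univ := by
    ext y
    simp only [subcube, Finset.mem_filter, Finset.mem_univ, true_and, Fintype.mem_piFinset]
    refine forall_congr' fun j => ?_
    split_ifs with hj <;> simp [hj]
  have h' : ∀ j, (if j ∈ J then {x j} else (Finset.univ : Finset (Fin 2))).card
      = if j ∈ J then 1 else 2 := fun j => by split_ifs <;> simp
  rw [h, Fintype.card_piFinset, Finset.prod_congr rfl fun j _ => h' j, Finset.prod_ite]
  simp [Finset.filter_not, Finset.card_sdiff]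

/-- The exponents are `±1 / 50` shifted by `-1 / 2500`. The shift outweighs the factor `cosh (1 /
50) ≤ exp (1 / 5000)`, leaving a net `exp (-1 / 5000)`. -/
lemma exp_add_exp_le : Real.exp (49 / 2500) + Real.exp (-(51 / 2500)) ≤ 2 - 2 / 10000 := by
  have h1 : Real.exp (49 / 2500) + Real.exp (-(51 / 2500))
      = 2 * (Real.exp (-(1 / 2500)) * Real.cosh (1 / 50)) := by
    rw [Real.cosh_eq, mul_div_assoc', mul_div_cancel₀ _ two_ne_zero, mul_add, ← Real.exp_add,
      ← Real.exp_add]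
    norm_num
  have h2 : Real.exp (-(1 / 2500)) * Real.cosh (1 / 50) ≤ Real.exp (-(1 / 5000)) := by
    refine (mul_le_mul_of_nonneg_left (Real.cosh_le_exp_half_sq _) (Real.exp_nonneg _)).trans ?_
    rw [← Real.exp_add]
    norm_num
  have h3 : Real.exp (-(1 / 5000)) ≤ 1 - 1 / 10000 := by
    rw [Real.exp_neg]
    refine (inv_anti₀ (by norm_num) (Real.add_one_le_exp _)).trans ?_
    norm_num
  linarith

lemma Fin.two_ne_iff_eq_one_sub (u e : Fin 2) : ¬ u = e ↔ u = 1 - e := by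
  revert u e
  decide

/-- The moment generating function of a tilted count, over a uniformly random codeword. -/
lemma sum_exp_tilt_le (J : Finset (Fin n)) (x : BitString n) {i : Fin n} (hi : i ∉ J) (e : Fin 2) :
    ∑ y : BitString n, Real.exp (if y ∈ subcube J x then
        (if y i = e then 49 / 2500 else -(51 / 2500)) else 0)
      ≤ 2 ^ n * (1 - (1 / 2) ^ J.card / 10000) := by
  have hcardJ : J.card + 1 ≤ n := by
    have := Finset.card_le_univ (insert i J)
    rwa [Finset.card_insert_of_notMem hi, Fintype.card_fin] at this
  have hhalf : ∀ e', (((subcube J x).filter fun y => y i = e').card : ℝ)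
      = 2 ^ n * (1 / 2) ^ J.card / 2 := by
    intro e'
    rw [← subcube_insert_update hi, card_subcube, Finset.card_insert_of_notMem hi]
    push_cast
    have : (2 : ℝ) ^ n = 2 ^ (n - (J.card + 1)) * 2 ^ J.card * 2 := by
      rw [mul_assoc, ← pow_succ, ← pow_add]; congr 1; omega
    rw [this, one_div, inv_pow]
    field_simp
  have hnot : ((subcube J x).filter fun y => ¬ y i = e) =
      (subcube J x).filter fun y => y i = 1 - e :=
    Finset.filter_congr fun y _ => Fin.two_ne_iff_eq_one_sub _ _
  have h1 : ∀ y : BitString n, Real.exp (if y ∈ subcube J x then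
      (if y i = e then 49 / 2500 else -(51 / 2500)) else 0) = 1 + if y ∈ subcube J x then
      (if y i = e then Real.exp (49 / 2500) - 1 else Real.exp (-(51 / 2500)) - 1) else 0 := by
    intro y
    split_ifs <;> simp
  have h2 := exp_add_exp_le
  have h3 : (0 : ℝ) ≤ 2 ^ n * (1 / 2) ^ J.card / 2 := by positivity
  rw [Finset.sum_congr rfl fun y _ => h1 y, Finset.sum_add_distrib, Finset.sum_ite_mem,
    Finset.univ_inter, Finset.sum_ite, Finset.sum_const, Finset.sum_const, Finset.sum_const, hnot,
    nsmul_eq_mul, nsmul_eq_mul, nsmul_eq_mul, hhalf, hhalf]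
  simp only [Finset.card_univ, Fintype.card_pi, Fintype.card_fin, Finset.prod_const, mul_one]
  push_cast
  have h4 := mul_le_mul_of_nonneg_left h2 h3
  linarith

-- Imbalance means a positive sum of independent tilts, worth `(1 / 25) * (1 - 51 / 100)` or `-(1 /
-- 25) * (51 / 100)` on the fiber and `0` off it. Each of the `2 ^ k` messages contributes a factor
-- `1 - 2 ^ (-J.card) / 10000` relative to the uniform count.
open scoped Classical in
lemma card_unbalanced_at_le (J : Finset (Fin n)) (x : BitString n) {i : Fin n} (hi : i ∉ J)
    (e : Fin 2) (hJ : J.card ≤ k) :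
    ((Finset.univ.filter fun C : Code k n => ¬ ((((codeFiber C J x).filter
      fun s => C s i = e).card : ℝ) ≤ 51 / 100 * (codeFiber C J x).card)).card : ℝ)
      ≤ Fintype.card (Code k n) * Real.exp (-(2 ^ (k - J.card) / 10000)) := by
  set Y : BitString n → ℝ := fun y =>
    if y ∈ subcube J x then (if y i = e then 49 / 2500 else -(51 / 2500)) else 0 with hY
  have hsum : ∀ C : Code k n, ∑ s, Y (C s) = 1 / 25 *
      ((((codeFiber C J x).filter fun s => C s i = e).card : ℝ)
        - 51 / 100 * (codeFiber C J x).card) := by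
    intro C
    have h1 : ∑ s, Y (C s) = ∑ s ∈ codeFiber C J x,
        (if C s i = e then (49 / 2500 : ℝ) else -(51 / 2500)) := by
      rw [codeFiber, Finset.sum_filter]
    have h2 := Finset.card_filter_add_card_filter_not (s := codeFiber C J x) (fun s => C s i = e)
    rw [h1, Finset.sum_ite, Finset.sum_const, Finset.sum_const, ← h2]
    push_cast
    simp only [nsmul_eq_mul]
    ring
  have hset : (Finset.univ.filter fun C : Code k n => ¬ ((((codeFiber C J x).filter
      fun s => C s i = e).card : ℝ) ≤ 51 / 100 * (codeFiber C J x).card))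
      = Finset.univ.filter fun C : Code k n => 0 < ∑ s, Y (C s) := by
    refine Finset.filter_congr fun C _ => ?_
    rw [hsum, not_le, mul_pos_iff_of_pos_left (by norm_num), sub_pos]
  have hexp : ∑ y, Real.exp (Y y) ≤ 2 ^ n * (1 - (1 / 2) ^ J.card / 10000) :=
    sum_exp_tilt_le J x hi e
  rw [hset]
  refine (card_filter_sum_pos_le (S := BitString k) Y).trans ?_
  have h0 : 0 ≤ ∑ y, Real.exp (Y y) := Finset.sum_nonneg fun y _ => Real.exp_nonneg _
  refine (pow_le_pow_left₀ h0 hexp _).trans ?_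
  rw [mul_pow]
  simp only [Fintype.card_pi, Fintype.card_fin, Finset.prod_const, Finset.card_univ, Nat.cast_pow,
    Nat.cast_ofNat]
  refine mul_le_mul_of_nonneg_left ?_ (by positivity)
  have h4 : (1 - (1 / 2 : ℝ) ^ J.card / 10000) ≤ Real.exp (-((1 / 2) ^ J.card / 10000)) := by
    have := Real.add_one_le_exp (-((1 / 2 : ℝ) ^ J.card / 10000))
    linarith
  have h5 : (0 : ℝ) ≤ 1 - (1 / 2 : ℝ) ^ J.card / 10000 := by
    have : (1 / 2 : ℝ) ^ J.card ≤ 1 := pow_le_one₀ (by norm_num) (by norm_num)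
    linarith
  refine (pow_le_pow_left₀ h5 h4 _).trans (le_of_eq ?_)
  rw [← Real.exp_nat_mul]
  congr 1
  have : (2 : ℝ) ^ k = 2 ^ (k - J.card) * 2 ^ J.card := by
    rw [← pow_add, Nat.sub_add_cancel hJ]
  push_cast
  rw [this, one_div, inv_pow]
  field_simp

-- Union bound over the set, the prescribed bits, the coordinate and its value, at most `2 ^ n * 2 ^
-- n * n * 2` choices.
open scoped Classical in
lemma card_not_isBalanced_le {m : ℕ} (hm : m ≤ k) :
    ((Finset.univ.filter fun C : Code k n => ¬ IsBalanced m C).card : ℝ)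
      ≤ 2 * n * 4 ^ n * Real.exp (-(2 ^ (k - m) / 10000)) * Fintype.card (Code k n) := by
  set I := (Finset.univ : Finset (Finset (Fin n) × BitString n × Fin n × Fin 2)).filter
    fun j => j.1.card ≤ m ∧ j.2.2.1 ∉ j.1 with hI
  set B : Finset (Fin n) × BitString n × Fin n × Fin 2 → Finset (Code k n) := fun j =>
    Finset.univ.filter fun C : Code k n => ¬ ((((codeFiber C j.1 j.2.1).filter
      fun s => C s j.2.2.1 = j.2.2.2).card : ℝ) ≤ 51 / 100 * (codeFiber C j.1 j.2.1).card) with hB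
  have hsub : (Finset.univ.filter fun C : Code k n => ¬ IsBalanced m C) ⊆ I.biUnion B := by
    intro C hC
    simp only [IsBalanced, Finset.mem_filter, Finset.mem_univ, true_and, not_forall] at hC
    obtain ⟨J, hJ, x, i, hi, e, h⟩ := hC
    refine Finset.mem_biUnion.2 ⟨(J, x, i, e), ?_, ?_⟩
    · simp [hI, hJ, hi]
    · exact Finset.mem_filter.2 ⟨Finset.mem_univ _, h⟩
  have hIcard : (I.card : ℝ) ≤ 2 * n * 4 ^ n := by
    have h : I.card ≤ 2 ^ n * (2 ^ n * (n * 2)) := by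
      refine (Finset.card_filter_le _ _).trans ?_
      simp [Fintype.card_prod]
    have h' : (I.card : ℝ) ≤ 2 ^ n * (2 ^ n * (n * 2)) := by exact_mod_cast h
    refine h'.trans (le_of_eq ?_)
    rw [show (4 : ℝ) = 2 * 2 by norm_num, mul_pow]
    ring
  calc ((Finset.univ.filter fun C : Code k n => ¬ IsBalanced m C).card : ℝ)
      ≤ ((I.biUnion B).card : ℝ) := by exact_mod_cast Finset.card_le_card hsub
    _ ≤ ∑ j ∈ I, ((B j).card : ℝ) := by exact_mod_cast Finset.card_biUnion_le
    _ ≤ ∑ j ∈ I, Fintype.card (Code k n) * Real.exp (-(2 ^ (k - m) / 10000)) := by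
      refine Finset.sum_le_sum fun j hj => ?_
      obtain ⟨hj1, hj2⟩ := (Finset.mem_filter.1 hj).2
      refine (card_unbalanced_at_le j.1 j.2.1 hj2 j.2.2.2 (hj1.trans hm)).trans ?_
      refine mul_le_mul_of_nonneg_left (Real.exp_le_exp.2 ?_) (Nat.cast_nonneg _)
      have : (2 : ℝ) ^ (k - m) ≤ 2 ^ (k - j.1.card) :=
        pow_le_pow_right₀ (by norm_num) (by omega)
      linarith
    _ ≤ _ := by
      rw [Finset.sum_const, nsmul_eq_mul]
      have h := mul_le_mul_of_nonneg_right hIcard (show (0 : ℝ) ≤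
        Fintype.card (Code k n) * Real.exp (-(2 ^ (k - m) / 10000)) by positivity)
      linarith

open scoped Classical in
lemma codeProb_eq (P : Code k n → Code k n → Prop) :
    codeProb P = ((Finset.univ.filter fun CD : Code k n × Code k n => P CD.1 CD.2).card : ℝ)
      / Fintype.card (Code k n × Code k n) := by
  have h : ({CD | P CD.1 CD.2} : Set (Code k n × Code k n))
      = ↑(Finset.univ.filter fun CD : Code k n × Code k n => P CD.1 CD.2) := by
    ext; simp
  rw [codeProb, h, MeasureTheory.measureReal_def, ProbabilityTheory.uniformOn_univ,
    MeasureTheory.Measure.count_apply_finset]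
  simp

/-- Two independent random codes are both balanced except with doubly exponentially small
probability. -/
lemma one_sub_le_codeProb_of_isBalanced {m : ℕ} (hm : m ≤ k) {P : Code k n → Code k n → Prop}
    (hP : ∀ C D, IsBalanced m C → IsBalanced m D → P C D) :
    1 - 4 * n * 4 ^ n * Real.exp (-(2 ^ (k - m) / 10000)) ≤ codeProb P := by
  classical
  have hN : (0 : ℝ) < Fintype.card (Code k n) := by exact_mod_cast Fintype.card_pos
  rw [codeProb_eq, Fintype.card_prod, Nat.cast_mul, le_div_iff₀ (by positivity)]
  set B := Finset.univ.filter fun C : Code k n => ¬ IsBalanced m C with hB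
  have hcover : (Finset.univ : Finset (Code k n × Code k n)) ⊆
      (Finset.univ.filter fun CD : Code k n × Code k n => P CD.1 CD.2) ∪
        (B ×ˢ Finset.univ ∪ Finset.univ ×ˢ B) := by
    rintro ⟨C, D⟩ -
    by_cases h1 : IsBalanced m C
    · by_cases h2 : IsBalanced m D
      · simp [hP C D h1 h2]
      · simp [hB, h2]
    · simp [hB, h1]
  have h := (Finset.card_le_card hcover).trans ((Finset.card_union_le _ _).trans
    (Nat.add_le_add_left (Finset.card_union_le _ _) _))
  rw [Finset.card_product, Finset.card_product, Finset.card_univ, Finset.card_univ,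
    Fintype.card_prod] at h
  have h' : (Fintype.card (Code k n) : ℝ) * Fintype.card (Code k n) ≤
      ((Finset.univ.filter fun CD : Code k n × Code k n => P CD.1 CD.2).card : ℝ) +
        (B.card * Fintype.card (Code k n) + Fintype.card (Code k n) * B.card) := by
    exact_mod_cast h
  have hb := mul_le_mul_of_nonneg_right (card_not_isBalanced_le (k := k) (n := n) hm) hN.le
  rw [← hB] at hb
  linarith

end RandomCode

/-! ### Mutual information with a uniform source -/

section Entropy

variable {Z Ω : Type*} [Fintype Z] [Fintype Ω] [Nonempty Ω] {P : Z → Ω → ℝ} {W : Z → ℝ}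

lemma mutualInfo_uniform_eq (hP1 : ∀ ω, ∑ z, P z ω = 1) :
    mutualInfo (fun z ω => P z ω / Fintype.card Ω)
      = (∑ z, ∑ ω, P z ω * Real.logb 2 (P z ω)) / Fintype.card Ω
        - ∑ z, (∑ ω, P z ω / Fintype.card Ω) * Real.logb 2 (∑ ω, P z ω / Fintype.card Ω) := by
  have hN : (Fintype.card Ω : ℝ) ≠ 0 := by exact_mod_cast Fintype.card_ne_zero
  have h : ∀ ω, ∑ z, P z ω / Fintype.card Ω = 1 / Fintype.card Ω := fun ω => by
    rw [← Finset.sum_div, hP1]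
  unfold mutualInfo condEntropy shannonEntropy
  have h2 : ∀ z ω, P z ω / (Fintype.card Ω : ℝ) / (1 / Fintype.card Ω) = P z ω := fun z ω => by
    field_simp
  simp only [h, h2, mul_neg, Finset.sum_neg_distrib, ← Finset.mul_sum]
  rw [Finset.sum_comm]
  ring

/-- Symmetry of mutual information: `mutualInfo` is computed from the entropy of the output, whereas
here the conditioning is on the output. -/
lemma condEntropy_uniform_eq (hP : ∀ z ω, 0 ≤ P z ω) (hP1 : ∀ ω, ∑ z, P z ω = 1) :
    condEntropy (fun ω z => P z ω / Fintype.card Ω)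
      = Real.logb 2 (Fintype.card Ω) - mutualInfo (fun z ω => P z ω / Fintype.card Ω) := by
  have hN : (Fintype.card Ω : ℝ) ≠ 0 := by exact_mod_cast Fintype.card_ne_zero
  have hN0 : (0 : ℝ) ≤ Fintype.card Ω := Nat.cast_nonneg _
  rw [mutualInfo_uniform_eq hP1]
  unfold condEntropy shannonEntropy
  set R : Z → ℝ := fun z => ∑ ω, P z ω / Fintype.card Ω with hR
  have key : ∀ z, (∑ ω, P z ω / Fintype.card Ω) *
      -∑ ω, P z ω / Fintype.card Ω / (∑ ω', P z ω' / Fintype.card Ω) *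
        Real.logb 2 (P z ω / Fintype.card Ω / ∑ ω', P z ω' / Fintype.card Ω)
      = R z * Real.logb 2 (Fintype.card Ω) + R z * Real.logb 2 (R z)
        - (∑ ω, P z ω * Real.logb 2 (P z ω)) / Fintype.card Ω := by
    intro z
    change R z * -∑ ω, P z ω / Fintype.card Ω / R z *
        Real.logb 2 (P z ω / Fintype.card Ω / R z) = _
    rcases eq_or_ne (R z) 0 with h0 | h0
    · have hz : ∀ ω, P z ω = 0 := fun ω => by
        have := (Finset.sum_eq_zero_iff_of_nonneg
          (fun ω _ => div_nonneg (hP z ω) hN0)).1 h0 ω (Finset.mem_univ ω)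
        simpa [hN] using this
      simp [h0, hz]
    have hterm : ∀ ω, P z ω / Fintype.card Ω / R z * Real.logb 2 (P z ω / Fintype.card Ω / R z)
        = (P z ω * Real.logb 2 (P z ω) / Fintype.card Ω
          - P z ω / Fintype.card Ω * (Real.logb 2 (Fintype.card Ω) + Real.logb 2 (R z)))
          / R z := by
      intro ω
      rcases eq_or_ne (P z ω) 0 with hp | hp
      · simp [hp]
      rw [Real.logb_div (div_ne_zero hp hN) h0, Real.logb_div hp hN]
      ring
    rw [Finset.sum_congr rfl fun ω _ => hterm ω, ← Finset.sum_div, mul_neg, mul_div_cancel₀ _ h0,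
      Finset.sum_sub_distrib, ← Finset.sum_mul, Finset.sum_div]
    ring
  have hR1 : ∑ z, R z = 1 := by
    simp only [hR]
    rw [Finset.sum_comm]
    simp only [← Finset.sum_div, hP1]
    simp [hN]
  rw [Finset.sum_congr rfl fun z _ => key z, Finset.sum_sub_distrib, Finset.sum_add_distrib,
    ← Finset.sum_mul, hR1, ← Finset.sum_div]
  ring

/-- The mutual information is bounded by the mean divergence from any reference distribution. -/
lemma mutualInfo_uniform_le (hP : ∀ z ω, 0 ≤ P z ω) (hP1 : ∀ ω, ∑ z, P z ω = 1)
    (hW : ∀ z, 0 ≤ W z) (hW1 : ∑ z, W z = 1) (hPW : ∀ z ω, W z = 0 → P z ω = 0) :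
    mutualInfo (fun z ω => P z ω / Fintype.card Ω)
      ≤ (∑ z, ∑ ω, P z ω * Real.logb 2 (P z ω / W z)) / Fintype.card Ω := by
  have hN : (Fintype.card Ω : ℝ) ≠ 0 := by exact_mod_cast Fintype.card_ne_zero
  have hN0 : (0 : ℝ) ≤ Fintype.card Ω := Nat.cast_nonneg _
  set R : Z → ℝ := fun z => ∑ ω, P z ω / Fintype.card Ω with hR
  have hR1 : ∑ z, R z = 1 := by
    simp only [hR]
    rw [Finset.sum_comm]
    simp only [← Finset.sum_div, hP1]
    simp [hN]
  have hRW : ∀ z, W z = 0 → R z = 0 := fun z hz => by simp [hR, hPW z _ hz]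
  -- The mean divergence from `W` exceeds the mutual information by exactly the divergence of the
  -- output law `R` from `W`.
  have hgibbs := sum_mul_logb_div_nonneg (p := R) (w := W)
    (fun z => Finset.sum_nonneg fun ω _ => div_nonneg (hP z ω) hN0) hW hRW (by rw [hR1, hW1])
  have e1 : ∑ z, R z * Real.logb 2 (R z / W z)
      = ∑ z, R z * Real.logb 2 (R z) - ∑ z, R z * Real.logb 2 (W z) := by
    rw [← Finset.sum_sub_distrib]
    refine Finset.sum_congr rfl fun z _ => ?_
    rcases eq_or_ne (R z) 0 with h | h
    · simp [h]
    rw [Real.logb_div h fun h' => h (hRW z h')]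
    ring
  have e2 : (∑ z, ∑ ω, P z ω * Real.logb 2 (P z ω / W z)) / Fintype.card Ω
      = (∑ z, ∑ ω, P z ω * Real.logb 2 (P z ω)) / Fintype.card Ω
        - ∑ z, R z * Real.logb 2 (W z) := by
    have : ∑ z, R z * Real.logb 2 (W z)
        = (∑ z, ∑ ω, P z ω * Real.logb 2 (W z)) / Fintype.card Ω := by
      rw [Finset.sum_div]
      refine Finset.sum_congr rfl fun z _ => ?_
      rw [← Finset.sum_mul, hR]
      simp only [← Finset.sum_div]
      ring
    rw [this, ← sub_div, ← Finset.sum_sub_distrib]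
    congr 1
    refine Finset.sum_congr rfl fun z _ => ?_
    rw [← Finset.sum_sub_distrib]
    refine Finset.sum_congr rfl fun ω _ => ?_
    rcases eq_or_ne (P z ω) 0 with h | h
    · simp [h]
    rw [Real.logb_div h fun h' => h (hPW z ω h')]
    ring
  rw [mutualInfo_uniform_eq hP1, e2]
  linarith

end Entropy

/-! ### Information gain of a strategy on balanced codes -/

section Strategy

variable {n k : ℕ}

/-- The probability of outcome `ζ` at step `a` after the history `h`, on `|E(s,t)⟩`. -/
def OnePassLOCC.stepProb (M : OnePassLOCC n 2) (C D : Code k n) (a : Fin n)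
    (h : Fin a.val → Fin 2) (ζ : Fin 2) (st : BitString k × BitString k) : ℝ :=
  response (M.povm a h ζ) (C st.1 (M.qubit a h)) (D st.2 (M.qubit a h))

lemma sum_outcomeProb_mul_logb_le (M : OnePassLOCC n 2) {C D : Code k n} {m : ℕ}
    (hC : IsBalanced m C) (hD : IsBalanced m D) :
    ∑ z, ∑ st, pathProd (fun a h ζ => M.stepProb C D a h ζ st) z *
        Real.logb 2 (pathProd (fun a h ζ => M.stepProb C D a h ζ st) z /
          pathProd (fun a h ζ => weight (M.povm a h ζ)) z)
      ≤ (∑ a : Fin n, if a.val ≤ 2 * m then 3 / 5 else 1) *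
        Fintype.card (BitString k × BitString k) := by
  have hresp : ∀ a h ζ, IsQubitResponse (response (M.povm a h ζ)) (weight (M.povm a h ζ)) :=
    fun a h ζ => isQubitResponse_response (M.posSemidef a h ζ)
  have hsum : ∀ a h c d, ∑ ζ, response (M.povm a h ζ) c d = 1 :=
    fun a h c d => sum_response (M.sum_eq_one a h) c d
  have hwsum : ∀ a h, ∑ ζ, weight (M.povm a h ζ) = 1 := fun a h => sum_weight (M.sum_eq_one a h)
  refine sum_pathProd_mul_logb_le (M.stepProb C D) _ _ (fun a h st => hsum a h _ _)
    (fun a h ζ st hw => (hresp a h ζ).eq_zero_of_weight hw _ _) fun a h => ?_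
  set g := stepDivergence (fun ζ => response (M.povm a h ζ)) (fun ζ => weight (M.povm a h ζ))
  change ∑ st : BitString k × BitString k,
    pathProd (stepsBefore (fun a h ζ => M.stepProb C D a h ζ st) a) h *
      g (C st.1 (M.qubit a h)) (D st.2 (M.qubit a h)) ≤ _
  split_ifs with ha
  -- `M.measured_once` speaks of full paths, so the history is padded; the value `0` past step `a`
  -- plays no role.
  · let z : Fin n → Fin 2 := fun j => if hj : j.val < a.val then h ⟨j.val, hj⟩ else 0
    have hza : history z a = h := by
      funext j
      exact dif_pos j.isLt
    have hzb : ∀ b : Fin a.val, history z (Fin.castLE a.isLt.le b) = history h b := by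
      intro b
      funext j
      exact dif_pos (show j.val < a.val from j.isLt.trans b.isLt)
    refine sum_prod_response_mul_le
      (Q := fun b : Fin a.val => M.qubit (Fin.castLE a.isLt.le b) (history h b))
      (r := fun b => response (M.povm (Fin.castLE a.isLt.le b) (history h b) (h b)))
      ?_ (fun b => (hresp _ _ _).exists_decomposition) hC hD ?_
      (stepDivergence_nonneg (hresp a h) (hsum a h) (hwsum a h))
      (stepDivergence_row_le (hresp a h) (hsum a h) (hwsum a h))
      (stepDivergence_col_le (hresp a h) (hsum a h) (hwsum a h)) (by simpa using ha)
    · intro b b' hbb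
      simp only [← hzb] at hbb
      exact Fin.castLE_injective _ (M.measured_once z hbb)
    · intro b hb
      rw [← hzb, ← hza] at hb
      have := congrArg Fin.val (M.measured_once z hb)
      exact b.isLt.ne this
  · rw [one_mul]
    refine Finset.sum_le_sum fun st _ => mul_le_of_le_one_right ?_
      (stepDivergence_le_one (hresp a h) (hsum a h) _ _)
    exact Finset.prod_nonneg fun b _ => (hresp _ _ _).nonneg _ _

/-- If `n ≥ 2 * m`, only the first `2 * m` steps are counted at `3 / 5`; step `2 * m` qualifies too
but is charged `1`. -/
lemma sum_step_bound_le (m : ℕ) :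
    ∑ a : Fin n, (if a.val ≤ 2 * m then (3 / 5 : ℝ) else 1)
      ≤ max (3 / 5 * (n : ℝ)) (n - 4 / 5 * m) := by
  rw [Fin.sum_univ_eq_sum_range (fun a => if a ≤ 2 * m then (3 / 5 : ℝ) else 1)]
  rcases le_total n (2 * m) with h | h
  · refine le_max_of_le_left (le_of_eq ?_)
    rw [Finset.sum_congr rfl fun a ha => if_pos ((Finset.mem_range.1 ha).le.trans h)]
    simp [mul_comm]
  · refine le_max_of_le_right ?_
    obtain ⟨j, rfl⟩ := Nat.exists_eq_add_of_le h
    rw [Finset.sum_range_add]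
    have h1 : ∑ a ∈ Finset.range (2 * m), (if a ≤ 2 * m then (3 / 5 : ℝ) else 1)
        = 2 * m * (3 / 5) := by
      rw [Finset.sum_congr rfl fun a ha => if_pos (Finset.mem_range.1 ha).le]
      simp
    have h2 : ∑ a ∈ Finset.range j, (if 2 * m + a ≤ 2 * m then (3 / 5 : ℝ) else 1) ≤ j := by
      refine (Finset.sum_le_card_nsmul _ _ 1 fun a _ => ?_).trans (by simp)
      split_ifs <;> norm_num
    rw [h1]
    push_cast
    linarith

/-- On balanced codes every strategy gains little information. -/
theorem infoGain_le (M : OnePassLOCC n 2) {C D : Code k n} {m : ℕ}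
    (hC : IsBalanced m C) (hD : IsBalanced m D) :
    M.infoGain C D ≤ max (3 / 5 * (n : ℝ)) (n - 4 / 5 * m) ∧
      M.remainingEntropy C D = 2 * k - M.infoGain C D := by
  have hcard : (Fintype.card (BitString k × BitString k) : ℝ) = 4 ^ k := by
    simp only [Fintype.card_prod, Fintype.card_pi, Fintype.card_fin, Finset.prod_const,
      Finset.card_univ]
    push_cast
    rw [← mul_pow]
    norm_num
  have hresp : ∀ a h ζ, IsQubitResponse (response (M.povm a h ζ)) (weight (M.povm a h ζ)) :=
    fun a h ζ => isQubitResponse_response (M.posSemidef a h ζ)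
  set P : (Fin n → Fin 2) → BitString k × BitString k → ℝ :=
    fun z st => pathProd (fun a h ζ => M.stepProb C D a h ζ st) z
  have hjoint : ∀ z st, M.jointProb C D z st
      = P z st / Fintype.card (BitString k × BitString k) := by
    intro z st
    rw [OnePassLOCC.jointProb, M.outcomeProb_otmState, hcard]
    rfl
  have hP : ∀ z st, 0 ≤ P z st := fun z st =>
    Finset.prod_nonneg fun a _ => (hresp _ _ _).nonneg _ _
  have hP1 : ∀ st, ∑ z, P z st = 1 := fun st =>
    sum_pathProd _ fun a h => sum_response (M.sum_eq_one a h) _ _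
  have hinfo : M.infoGain C D = mutualInfo fun z st =>
      P z st / Fintype.card (BitString k × BitString k) := by
    simp only [OnePassLOCC.infoGain, hjoint]
  refine ⟨?_, ?_⟩
  · rw [hinfo]
    refine (mutualInfo_uniform_le
      (W := pathProd (fun a h ζ => weight (M.povm a h ζ))) hP hP1
      (fun z => Finset.prod_nonneg fun a _ => (hresp _ _ _).weight_nonneg)
      (sum_pathProd _ fun a h => sum_weight (M.sum_eq_one a h)) fun z st hz => ?_).trans ?_
    · obtain ⟨a, -, ha⟩ := Finset.prod_eq_zero_iff.1 hz
      exact Finset.prod_eq_zero (Finset.mem_univ a) ((hresp _ _ _).eq_zero_of_weight ha _ _)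
    · rw [div_le_iff₀ (by rw [hcard]; positivity)]
      exact (sum_outcomeProb_mul_logb_le M hC hD).trans
        (mul_le_mul_of_nonneg_right (sum_step_bound_le m) (Nat.cast_nonneg _))
  · rw [hinfo]
    simp only [OnePassLOCC.remainingEntropy, hjoint]
    rw [condEntropy_uniform_eq hP hP1, hcard, Real.logb_pow,
      show (4 : ℝ) = 2 ^ (2 : ℕ) by norm_num, Real.logb_pow, Real.logb_self_eq_one one_lt_two]
    push_cast
    ring

end Strategy

/-! ### Numerical estimates for the rate and the failure probability -/

lemma binEntropy_sin_sq_pi_div_eight_le :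
    Real.binEntropy (Real.sin (Real.pi / 8) ^ 2) ≤ 0.43 := by
  have hs : Real.sin (Real.pi / 8) ^ 2 = (1 - Real.sqrt 2 / 2) / 2 := by
    have h := Real.cos_sq_add_sin_sq (Real.pi / 8)
    have h2 := Real.cos_two_mul (Real.pi / 8)
    rw [show 2 * (Real.pi / 8) = Real.pi / 4 by ring, Real.cos_pi_div_four] at h2
    linarith
  have hlo : 1.4142 ≤ Real.sqrt 2 := Real.le_sqrt_of_sq_le (by norm_num)
  have hhi : Real.sqrt 2 ≤ 1.4143 := Real.sqrt_le_iff.2 ⟨by norm_num, by norm_num⟩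
  set p := Real.sin (Real.pi / 8) ^ 2
  have hp1 : 0.1464 ≤ p := by rw [hs]; linarith
  have hp2 : p ≤ 0.14645 := by rw [hs]; linarith
  rw [Real.binEntropy]
  -- Scaling by `8` brings `p` to about `1.17`, where `log x ≥ 1 - 1 / x` is accurate enough.
  have h1 : Real.log p⁻¹ ≤ 1.9335 := by
    have h8 := Real.one_sub_inv_le_log_of_pos (show 0 < 8 * p by linarith)
    rw [Real.log_mul (by norm_num) (by linarith), show (8 : ℝ) = 2 ^ (3 : ℕ) by norm_num,
      Real.log_pow] at h8
    have hinv : (2 ^ 3 * p)⁻¹ ≤ 0.8539 := by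
      rw [inv_le_comm₀ (by linarith) (by norm_num)]
      norm_num
      linarith
    rw [Real.log_inv]
    have := Real.log_two_lt_d9
    push_cast at h8
    linarith
  have h2 : Real.log (1 - p)⁻¹ ≤ (1 - p)⁻¹ - 1 :=
    Real.log_le_sub_one_of_pos (inv_pos.2 (by linarith))
  have h3 : (1 - p) * Real.log (1 - p)⁻¹ ≤ p := by
    refine (mul_le_mul_of_nonneg_left h2 (by linarith)).trans (le_of_eq ?_)
    rw [mul_sub, mul_inv_cancel₀ (by linarith)]
    ring
  nlinarith

lemma le_bscCapacity : 0.379 ≤ bscCapacity := by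
  have h := binEntropy_sin_sq_pi_div_eight_le
  have h2 := Real.log_two_gt_d9
  have : Real.binEntropy (Real.sin (Real.pi / 8) ^ 2) / Real.log 2 ≤ 0.621 := by
    rw [div_le_iff₀ (by linarith)]
    linarith
  rw [bscCapacity]
  linarith

lemma exists_failure_bound : ∃ n₀ : ℕ, ∀ n : ℕ, n₀ ≤ n →
    4 * (n : ℝ) * 4 ^ n * Real.exp (-(2 ^ (n / 100) / 10000)) ≤ Real.exp (-1 * n) := by
  -- With `j = n / 100` and `n ≤ 200 * j`, this threshold gives `2 ^ j / 10000 ≥ 2000 * j ≥ 10 * n`;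
  -- the final comparison needs `8 * n`.
  have h := (tendsto_pow_const_div_const_pow_of_one_lt 1 (one_lt_two (α := ℝ))).eventually
    (gt_mem_nhds (show (0 : ℝ) < 1 / (10000 * 2000) by norm_num))
  obtain ⟨N, hN⟩ := Filter.eventually_atTop.1 h
  refine ⟨100 * (N + 1), fun n hn => ?_⟩
  set j := n / 100 with hj
  have hjN : N + 1 ≤ j := by omega
  have hnj : (n : ℝ) ≤ 200 * j := by
    have : n ≤ 200 * j := by omega
    exact_mod_cast this
  have h1 := hN j (by omega)
  rw [pow_one, div_lt_div_iff₀ (by positivity) (by norm_num)] at h1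
  have hb : ∀ x : ℝ, 4 * x ≤ Real.exp (4 * x) := fun x => by
    have := Real.add_one_le_exp (4 * x); linarith
  have h4 : (4 : ℝ) ^ n ≤ Real.exp (3 * n) := by
    rw [mul_comm, Real.exp_nat_mul]
    refine pow_le_pow_left₀ (by norm_num) ?_ _
    have := Real.add_one_le_exp (3 : ℝ)
    linarith
  calc 4 * (n : ℝ) * 4 ^ n * Real.exp (-(2 ^ j / 10000))
      ≤ Real.exp (4 * n) * Real.exp (3 * n) * Real.exp (-(2 ^ j / 10000)) := by
        gcongr
        exact hb n
    _ = Real.exp (4 * n + 3 * n + -(2 ^ j / 10000)) := by rw [Real.exp_add, Real.exp_add]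
    _ ≤ Real.exp (-1 * n) := Real.exp_le_exp.2 (by linarith)

end

/-! ### The main theorem -/

theorem mainTheorem1 :
    ∃ θ₀ : ℝ, 0 < θ₀ ∧ ∃ c : ℝ, 0 < c ∧ ∃ A : ℝ, ∃ n₀ : ℕ,
      ∀ (n k : ℕ) (θ : ℝ), n₀ ≤ n → 0 ≤ θ → θ ≤ θ₀ → (k : ℝ) = n * (bscCapacity - θ) →
        1 - Real.exp (-c * n) ≤ codeProb fun C D : Code k n =>
          ∀ M : OnePassLOCC n 2,
            M.infoGain C D ≤ 1.9190 * k + A * (Real.sqrt n * Real.log n) ∧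
            0.081 * k - A * (Real.sqrt n * Real.log n) ≤ M.remainingEntropy C D := by
  obtain ⟨n₀, hn₀⟩ := exists_failure_bound
  -- `θ₀ = 0.379 - 0.375`: the rate stays at least `0.375`, while the last estimate needs only
  -- `1.008 * n ≤ 2.719 * k`. That slack is why `A = 0` suffices.
  refine ⟨0.004, by norm_num, 1, one_pos, 0, n₀, fun n k θ hn _ hθ hk => ?_⟩
  have hkn : 0.375 * (n : ℝ) ≤ k := by
    have h := mul_le_mul_of_nonneg_left
      (show (0.375 : ℝ) ≤ bscCapacity - θ by linarith [le_bscCapacity]) (Nat.cast_nonneg (α := ℝ) n)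
    rw [hk]
    linarith
  have hdiv : ((n / 100 : ℕ) : ℝ) ≤ n / 100 := by exact_mod_cast Nat.cast_div_le (α := ℝ)
  have hle : n / 100 ≤ k := by
    have : ((n / 100 : ℕ) : ℝ) ≤ k := by linarith [Nat.cast_nonneg (α := ℝ) n]
    exact_mod_cast this
  -- Taking `m = k - n / 100` costs `0.008 * n` bits in the bound and leaves `2 ^ (n / 100)` in the
  -- failure exponent.
  have hprob := one_sub_le_codeProb_of_isBalanced (k := k) (n := n) (Nat.sub_le k (n / 100))
    (P := fun C D => ∀ M : OnePassLOCC n 2,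
      M.infoGain C D ≤ 1.9190 * k + 0 * (Real.sqrt n * Real.log n) ∧
      0.081 * k - 0 * (Real.sqrt n * Real.log n) ≤ M.remainingEntropy C D) ?_
  · rw [Nat.sub_sub_self hle] at hprob
    linarith [hn₀ n hn]
  · intro C D hC hD M
    obtain ⟨hI, hR⟩ := infoGain_le M hC hD
    have hm : ((k - n / 100 : ℕ) : ℝ) = k - (n / 100 : ℕ) := Nat.cast_sub hle
    have hn0 := Nat.cast_nonneg (α := ℝ) n
    have hbound : max (3 / 5 * (n : ℝ)) (n - 4 / 5 * (k - n / 100 : ℕ)) ≤ 1.9190 * k := by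
      rw [hm]
      exact max_le (by linarith) (by linarith)
    constructor <;> linarith
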